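/- Let $G$ be a finite simple connected graph on $n$ vertices. A vertex $v$ of a graph is a cut vertex if deleting $v$ leaves a disconnected graph. A block of $G$ is a maximal connected subgraph of $G$ that, regarded as a graph of its own, has no cut vertex. A block $B$ of $G$ is called good if there are two distinct vertices $u, v$ of $B$, both of them cut vertices of $G$, and a path in $B$ from $u$ to $v$ that contains all vertices of $B$; otherwise $B$ is called bad. Let $\mathrm{Bad}(G)$ be the set of bad blocks of $G$. The graph $G$ is a block graph if every block of $G$ is a clique, and a cactus graph if every block of $G$ is a cycle or an edge. Suppose that $G$ is a block graph or a cactus graph, and that $G$ has at least two blocks. Let $\mathrm{Opt}(G)$ be the maximum, over all spanning trees $T$ of $G$, of the number of internal vertices of $T$, i.e. of vertices whose degree in $T$ is at least $2$. Then $$\mathrm{Opt}(G) = n - |\mathrm{Bad}(G)|.$$ -/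

import Mathlib

namespace MIST

variable {V : Type*}

/-- `v` is a cut vertex of the graph `G`: the graph `G - v` is disconnected.
(The graph without vertices does not count as disconnected.) -/
def IsCutVertex (G : SimpleGraph V) (v : V) : Prop :=
  ¬ (G.induce {v}ᶜ).Preconnected

/-- `v` is a cut vertex of the subgraph `H` of `G`, where `H` is regarded as a graph of its own:
`v` is a vertex of `H` and `H - v` is disconnected. -/
def IsSubgraphCutVertex {G : SimpleGraph V} (H : G.Subgraph) (v : V) : Prop :=
  v ∈ H.verts ∧ ¬ (H.deleteVerts {v}).Preconnected

/-- A block of `G` is a maximal connected subgraph without cut vertices (of its own). -/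
def IsBlock {G : SimpleGraph V} (B : G.Subgraph) : Prop :=
  Maximal (fun H : G.Subgraph => H.Connected ∧ ∀ v, ¬ IsSubgraphCutVertex H v) B

/-- The block decomposition of `G`: the set of its blocks. -/
def blocks (G : SimpleGraph V) : Set G.Subgraph :=
  {B | IsBlock B}

/-- `H` has a spanning path between `u` and `v`: a path inside `H` from `u` to `v` which contains
all vertices of `H`. -/
def HasSpanningPath {G : SimpleGraph V} (H : G.Subgraph) (u v : V) : Prop :=
  ∃ p : G.Walk u v, p.IsPath ∧ p.toSubgraph ≤ H ∧ ∀ w ∈ H.verts, w ∈ p.support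

/-- A block is good if it has a spanning path between two distinct cut vertices of `G`. -/
def IsGood {G : SimpleGraph V} (B : G.Subgraph) : Prop :=
  ∃ u ∈ B.verts, ∃ v ∈ B.verts, u ≠ v ∧ IsCutVertex G u ∧ IsCutVertex G v ∧ HasSpanningPath B u v

/-- The set of bad blocks of `G`, that is, of the blocks which are not good. -/
def badBlocks (G : SimpleGraph V) : Set G.Subgraph :=
  {B | IsBlock B ∧ ¬ IsGood B}

/-- A block graph is a graph in which every block is a clique. -/
def IsBlockGraph (G : SimpleGraph V) : Prop :=
  ∀ B : G.Subgraph, IsBlock B → G.IsClique B.verts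

/-- The subgraph `H` is a cycle. -/
def IsCycleSubgraph {G : SimpleGraph V} (H : G.Subgraph) : Prop :=
  ∃ (u : V) (p : G.Walk u u), p.IsCycle ∧ H = p.toSubgraph

/-- The subgraph `H` is an edge (with its two ends). -/
def IsEdgeSubgraph {G : SimpleGraph V} (H : G.Subgraph) : Prop :=
  ∃ (u v : V) (h : G.Adj u v), H = G.subgraphOfAdj h

/-- A cactus graph is a graph in which every block is a cycle or an edge. -/
def IsCactusGraph (G : SimpleGraph V) : Prop :=
  ∀ B : G.Subgraph, IsBlock B → IsCycleSubgraph B ∨ IsEdgeSubgraph B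

/-- `T` is a spanning tree of `G`. As `T` lives on the vertex type of `G`, it is spanning. -/
def IsSpanningTree (G T : SimpleGraph V) : Prop :=
  T ≤ G ∧ T.IsTree

/-- The internal vertices of a graph: the vertices of degree at least two. -/
def internalVertices (T : SimpleGraph V) : Set V :=
  {v | 2 ≤ (T.neighborSet v).ncard}

/-- The numbers of internal vertices of the spanning trees of `G`. -/
def internalCounts (G : SimpleGraph V) : Set ℕ :=
  {k | ∃ T : SimpleGraph V, IsSpanningTree G T ∧ (internalVertices T).ncard = k}

end MIST

namespace MIST

/-! Leaves of a spanning tree are counted block by block. A leaf of a spanning tree is never a cut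
vertex of `G`, and a non-cut vertex lies in exactly one block (`IsBlock.eq_of_not_isCutVertex`).

At least one leaf per bad block: a bad clique has a single cut vertex `c`, and a vertex of it
farthest from `c` in the tree is a leaf. A bad cycle has no two adjacent cut vertices; if no non-cut
vertex on it were a leaf, the tree would contain both cycle edges at each of them, hence the whole
cycle. Leaves found in different bad blocks are distinct.

At most one, for a suitable tree: take in each block a spanning path that starts at a cut vertex
and, if the block is good, also ends at one. The union of these paths is a spanning tree, since
every cycle of `G` stays inside one block. A leaf of it must be the end of the path of a bad block.
-/

open SimpleGraph

variable {V : Type*} {G : SimpleGraph V}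

/-! ### Nonseparable subgraphs -/

/-- A connected subgraph without cut vertices of its own; blocks are the maximal ones. -/
def IsNonseparable (H : G.Subgraph) : Prop :=
  H.Connected ∧ ∀ v, ¬ IsSubgraphCutVertex H v

lemma isNonseparable_iff {H : G.Subgraph} :
    IsNonseparable H ↔ H.Connected ∧ ∀ v, (H.deleteVerts {v}).Preconnected := by
  refine and_congr_right fun hc => forall_congr' fun v => ?_
  unfold IsSubgraphCutVertex
  by_cases hv : v ∈ H.verts
  · simp [hv]
  · have : H.deleteVerts {v} = H := by
      rw [← Subgraph.deleteVerts_inter_verts_left_eq, Set.inter_singleton_eq_empty.2 hv,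
        Subgraph.deleteVerts_empty]
    simp [hv, this, hc.preconnected]

lemma preconnected_of_forall_exists_walk {H : G.Subgraph} (w : V)
    (h : ∀ x ∈ H.verts, ∃ p : G.Walk w x, p.toSubgraph ≤ H) : H.Preconnected := by
  rw [Subgraph.preconnected_iff_forall_exists_walk_subgraph]
  intro x y hx hy
  obtain ⟨p, hp⟩ := h x hx
  obtain ⟨q, hq⟩ := h y hy
  exact ⟨p.reverse.append q, by simp [Walk.toSubgraph_append, hp, hq]⟩

lemma toSubgraph_le_deleteVerts {H : G.Subgraph} {u v w : V} {p : G.Walk u v}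
    (hp : p.toSubgraph ≤ H) (hw : w ∉ p.support) : p.toSubgraph ≤ H.deleteVerts {w} := by
  constructor
  · intro x hx
    refine ⟨hp.1 hx, ?_⟩
    rintro rfl
    exact hw (p.mem_verts_toSubgraph.1 hx)
  · intro x y hxy
    rw [Subgraph.deleteVerts_adj]
    have hx := p.toSubgraph.edge_vert hxy
    have hy := p.toSubgraph.edge_vert hxy.symm
    refine ⟨hp.1 hx, ?_, hp.1 hy, ?_, hp.2 hxy⟩
    · rintro rfl
      exact hw (p.mem_verts_toSubgraph.1 hx)
    · rintro rfl
      exact hw (p.mem_verts_toSubgraph.1 hy)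

/-- Whichever vertex is deleted, `x` or `y` survives and still joins the two connected remainders.
-/
lemma IsNonseparable.sup {H K : G.Subgraph} (hH : IsNonseparable H) (hK : IsNonseparable K)
    {x y : V} (hxy : x ≠ y) (hxH : x ∈ H.verts) (hyH : y ∈ H.verts) (hxK : x ∈ K.verts)
    (hyK : y ∈ K.verts) : IsNonseparable (H ⊔ K) := by
  rw [isNonseparable_iff] at *
  refine ⟨Subgraph.connected_sup hH.1.preconnected hK.1.preconnected ⟨x, hxH, hxK⟩, fun v => ?_⟩
  have hne : (H.deleteVerts {v} ⊓ K.deleteVerts {v}).verts.Nonempty := by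
    by_cases hv : x = v
    · exact ⟨y, ⟨hyH, fun h => hxy (hv.trans h.symm)⟩, ⟨hyK, fun h => hxy (hv.trans h.symm)⟩⟩
    · exact ⟨x, ⟨hxH, hv⟩, ⟨hxK, hv⟩⟩
  refine ((Subgraph.connected_sup (hH.2 v) (hK.2 v) hne).mono
    (sup_le (Subgraph.deleteVerts_mono le_sup_left) (Subgraph.deleteVerts_mono le_sup_right))
    ?_).preconnected
  simp [Set.union_sdiff_distrib]

lemma IsNonseparable.mono {H K : G.Subgraph} (hle : H ≤ K) (hv : H.verts = K.verts)
    (hH : IsNonseparable H) : IsNonseparable K := by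
  rw [isNonseparable_iff] at *
  refine ⟨hH.1.mono hle hv, fun v => ?_⟩
  rw [Subgraph.preconnected_iff_forall_exists_walk_subgraph]
  intro x y hx hy
  obtain ⟨p, hp⟩ := (Subgraph.preconnected_iff_forall_exists_walk_subgraph _).1 (hH.2 v)
    (u := x) (v := y) (by simpa [hv] using hx) (by simpa [hv] using hy)
  exact ⟨p, hp.trans (Subgraph.deleteVerts_mono hle)⟩

lemma isNonseparable_subgraphOfAdj {u v : V} (h : G.Adj u v) :
    IsNonseparable (G.subgraphOfAdj h) := by
  rw [isNonseparable_iff]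
  refine ⟨Subgraph.subgraphOfAdj_connected h, fun w => ?_⟩
  rw [Subgraph.preconnected_iff_forall_exists_walk_subgraph]
  intro x y hx hy
  by_cases hxy : x = y
  · subst hxy
    exact ⟨.nil, by simpa using hx⟩
  · refine ⟨.cons (show G.Adj x y by
      simp at hx hy
      grind [SimpleGraph.adj_comm]) .nil, ?_⟩
    rw [Walk.toSubgraph_cons_nil_eq_subgraphOfAdj]
    apply subgraphOfAdj_le_of_adj
    simp at hx hy ⊢
    grind

/-- Rotated to start at the deleted vertex `v`, the cycle is an edge `vw` followed by a path from
`w` back to `v`; initial segments of that path reach every other vertex without meeting `v`. -/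
lemma isNonseparable_toSubgraph_of_isCycle {u : V} {p : G.Walk u u} (hp : p.IsCycle) :
    IsNonseparable p.toSubgraph := by
  classical
  refine ⟨p.toSubgraph_connected, ?_⟩
  rintro v ⟨hv, hcon⟩
  apply hcon
  rw [Walk.mem_verts_toSubgraph] at hv
  rw [← p.toSubgraph_rotate hv]
  have hc := hp.rotate hv
  generalize p.rotate v hv = c at hc
  cases c with
  | nil => exact absurd hc Walk.not_isCycle_nil
  | cons h q =>
    rename_i w
    rw [Walk.cons_isCycle_iff] at hc
    refine preconnected_of_forall_exists_walk w fun x hx => ?_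
    have hxv : x ≠ v := hx.2
    have hxq : x ∈ q.support := by
      have := hx.1
      rw [Walk.mem_verts_toSubgraph, Walk.support_cons, List.mem_cons] at this
      exact this.resolve_left hxv
    refine ⟨q.takeUntil x hxq, toSubgraph_le_deleteVerts ?_ ?_⟩
    · have h1 : (q.takeUntil x hxq).toSubgraph ≤ q.toSubgraph := by
        conv_rhs => rw [← q.take_spec hxq, Walk.toSubgraph_append]
        exact le_sup_left
      exact h1.trans (by simp [Walk.toSubgraph])
    · exact Walk.endpoint_notMem_support_takeUntil hc.1 hxq hxv.symm

/-! ### Blocks and cut vertices -/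

lemma IsBlock.isNonseparable {B : G.Subgraph} (hB : IsBlock B) : IsNonseparable B :=
  hB.prop

lemma IsBlock.eq_of_le {B K : G.Subgraph} (hB : IsBlock B) (hK : IsNonseparable K) (h : B ≤ K) :
    B = K :=
  Maximal.eq_of_le hB hK h

lemma IsBlock.eq_of_mem {B C : G.Subgraph} (hB : IsBlock B) (hC : IsBlock C)
    {x y : V} (hxy : x ≠ y) (hxB : x ∈ B.verts) (hyB : y ∈ B.verts) (hxC : x ∈ C.verts)
    (hyC : y ∈ C.verts) : B = C := by
  have h := hB.isNonseparable.sup hC.isNonseparable hxy hxB hyB hxC hyC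
  exact (hB.eq_of_le h le_sup_left).trans (hC.eq_of_le h le_sup_right).symm

lemma IsBlock.eq_induce {B : G.Subgraph} (hB : IsBlock B) :
    B = (⊤ : G.Subgraph).induce B.verts :=
  hB.eq_of_le (hB.isNonseparable.mono Subgraph.le_induce_top_verts rfl)
    Subgraph.le_induce_top_verts

lemma IsBlock.adj_iff {B : G.Subgraph} (hB : IsBlock B) {x y : V} :
    B.Adj x y ↔ x ∈ B.verts ∧ y ∈ B.verts ∧ G.Adj x y := by
  conv_lhs => rw [hB.eq_induce]
  simp

lemma IsBlock.toSubgraph_le {B : G.Subgraph} (hB : IsBlock B) {u v : V} {p : G.Walk u v}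
    (hp : ∀ w ∈ p.support, w ∈ B.verts) : p.toSubgraph ≤ B := by
  constructor
  · intro x hx
    exact hp x (p.mem_verts_toSubgraph.1 hx)
  · intro x y hxy
    rw [hB.adj_iff]
    exact ⟨hp x (p.mem_verts_toSubgraph.1 (p.toSubgraph.edge_vert hxy)),
      hp y (p.mem_verts_toSubgraph.1 (p.toSubgraph.edge_vert hxy.symm)), hxy.adj_sub⟩

lemma IsNonseparable.exists_isBlock_ge [Finite V] {H : G.Subgraph} (hH : IsNonseparable H) :
    ∃ B, IsBlock B ∧ H ≤ B := by
  obtain ⟨B, hle, hB⟩ := (Set.toFinite {K : G.Subgraph | IsNonseparable K}).exists_le_maximal hH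
  exact ⟨B, hB, hle⟩

lemma exists_isBlock_of_adj [Finite V] {x y : V} (h : G.Adj x y) :
    ∃ B : G.Subgraph, IsBlock B ∧ x ∈ B.verts ∧ y ∈ B.verts := by
  obtain ⟨B, hB, hle⟩ := (isNonseparable_subgraphOfAdj h).exists_isBlock_ge
  exact ⟨B, hB, hle.1 (by simp), hle.1 (by simp)⟩

lemma IsBlock.verts_nontrivial (hconn : G.Connected) (hnt : (blocks G).Nontrivial)
    {B : G.Subgraph} (hB : IsBlock B) : B.verts.Nontrivial := by
  by_contra hsub
  rw [Set.not_nontrivial_iff] at hsub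
  obtain ⟨v, hv⟩ := hB.isNonseparable.1.nonempty
  by_cases hV : Nontrivial V
  · obtain ⟨w, hw⟩ := hconn.preconnected.exists_adj_of_nontrivial v
    have hle : B ≤ G.subgraphOfAdj hw := by
      constructor
      · intro x hx
        simp [hsub hx hv]
      · intro x y hxy
        exact absurd (hsub (B.edge_vert hxy) (B.edge_vert hxy.symm)) hxy.ne
    have heq := hB.eq_of_le (isNonseparable_subgraphOfAdj hw) hle
    have hwB : w ∈ B.verts := by rw [heq]; simp
    exact hw.ne (hsub hv hwB)
  -- On a single vertex there is only one block, because blocks are nonempty induced subgraphs.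
  · rw [not_nontrivial_iff_subsingleton] at hV
    obtain ⟨C, hC, D, hD, hne⟩ := hnt
    apply hne
    rw [IsBlock.eq_induce hC, IsBlock.eq_induce hD]
    congr 1
    obtain ⟨c, hc⟩ := (IsBlock.isNonseparable hC).1.nonempty
    obtain ⟨d, hd⟩ := (IsBlock.isNonseparable hD).1.nonempty
    ext x
    rw [Subsingleton.elim x c]
    simp only [hc, true_iff]
    rwa [Subsingleton.elim c d]

lemma IsBlock.exists_adj {B : G.Subgraph} (hB : IsBlock B) (hnt : B.verts.Nontrivial) {v : V}
    (hv : v ∈ B.verts) : ∃ w, B.Adj v w := by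
  have : Nontrivial B.verts := hnt.coe_sort
  exact hB.isNonseparable.1.preconnected.exists_adj_of_nontrivial ⟨v, hv⟩

lemma exists_isPath_notMem_support {v a b : V} (hcut : ¬ IsCutVertex G v) (ha : a ≠ v)
    (hb : b ≠ v) : ∃ p : G.Walk a b, p.IsPath ∧ v ∉ p.support := by
  classical
  unfold IsCutVertex at hcut
  rw [not_not] at hcut
  obtain ⟨q⟩ := hcut ⟨a, ha⟩ ⟨b, hb⟩
  let q' := q.map (Embedding.induce ({v}ᶜ : Set V)).toHom
  refine ⟨q'.bypass, q'.bypass_isPath, fun h => ?_⟩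
  have := q'.support_bypass_subset_support h
  rw [Walk.support_map, List.mem_map] at this
  obtain ⟨x, -, hx⟩ := this
  exact x.2 hx

/-- Neighbours `a` and `b` of `v` in the two blocks are joined by a path avoiding `v`. Closed up
through `v` it is a cycle, and the block containing that cycle shares two vertices with `B` and two
with `C`. -/
lemma IsBlock.eq_of_not_isCutVertex [Finite V] {B C : G.Subgraph} (hB : IsBlock B)
    (hC : IsBlock C) (hBn : B.verts.Nontrivial) (hCn : C.verts.Nontrivial) {v : V}
    (hvB : v ∈ B.verts) (hvC : v ∈ C.verts) (hcut : ¬ IsCutVertex G v) : B = C := by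
  obtain ⟨a, ha⟩ := hB.exists_adj hBn hvB
  obtain ⟨b, hb⟩ := hC.exists_adj hCn hvC
  have haB := B.edge_vert ha.symm
  have hbC := C.edge_vert hb.symm
  by_cases hab : a = b
  · subst hab
    exact hB.eq_of_mem hC ha.ne hvB haB hvC hbC
  obtain ⟨p, hp, hvp⟩ := exists_isPath_notMem_support hcut ha.ne.symm hb.ne.symm
  have hcyc : (Walk.cons ha.adj_sub (p.concat hb.adj_sub.symm)).IsCycle := by
    rw [Walk.cons_isCycle_iff]
    refine ⟨hp.concat hvp _, ?_⟩
    rw [Walk.edges_concat]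
    simp only [List.concat_eq_append, List.mem_append, List.mem_singleton, not_or]
    refine ⟨fun h => hvp (p.fst_mem_support_of_mem_edges h), ?_⟩
    have := ha.ne
    simp [hab]
    tauto
  obtain ⟨D, hD, hle⟩ := (isNonseparable_toSubgraph_of_isCycle hcyc).exists_isBlock_ge
  have hmem : ∀ x ∈ (Walk.cons ha.adj_sub (p.concat hb.adj_sub.symm)).support, x ∈ D.verts :=
    fun x hx => hle.1 ((Walk.mem_verts_toSubgraph _).2 hx)
  have hvD := hmem v (by simp)
  have haD := hmem a (by simp [Walk.support_concat])
  have hbD := hmem b (by simp [Walk.support_concat])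
  exact (hB.eq_of_mem hD ha.ne hvB haB hvD haD).trans (hC.eq_of_mem hD hb.ne hvC hbC hvD hbD).symm

/-- An edge leaving `B` belongs to another block, so its end in `B` lies in two blocks. -/
lemma IsBlock.exists_isCutVertex [Finite V] (hconn : G.Connected) (hnt : (blocks G).Nontrivial)
    {B : G.Subgraph} (hB : IsBlock B) : ∃ v ∈ B.verts, IsCutVertex G v := by
  have hBn := hB.verts_nontrivial hconn hnt
  obtain ⟨C, hC, hCB⟩ := hnt.exists_ne B
  have hCn := IsBlock.verts_nontrivial hconn hnt hC
  obtain ⟨w, hwB⟩ : ∃ w, w ∉ B.verts := by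
    by_contra! hall
    obtain ⟨x, hx, y, hy, hxy⟩ := hCn
    exact hCB (IsBlock.eq_of_mem hC hB hxy hx hy (hall x) (hall y))
  obtain ⟨u, huB⟩ := hBn.nonempty
  obtain ⟨p⟩ := hconn.preconnected u w
  obtain ⟨d, -, hd1, hd2⟩ := p.exists_boundary_dart B.verts huB hwB
  refine ⟨d.fst, hd1, ?_⟩
  by_contra hcut
  obtain ⟨D, hD, h1, h2⟩ := exists_isBlock_of_adj d.adj
  have := hB.eq_of_not_isCutVertex hD hBn (hD.verts_nontrivial hconn hnt) hd1 h1 hcut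
  exact hd2 (this ▸ h2)

lemma IsBlock.adj_of_not_isCutVertex [Finite V] (hconn : G.Connected)
    (hnt : (blocks G).Nontrivial) {B : G.Subgraph} (hB : IsBlock B) {v w : V}
    (hv : v ∈ B.verts) (hcut : ¬ IsCutVertex G v) (h : G.Adj v w) : B.Adj v w := by
  obtain ⟨D, hD, h1, h2⟩ := exists_isBlock_of_adj h
  obtain rfl := hB.eq_of_not_isCutVertex hD (hB.verts_nontrivial hconn hnt)
    (hD.verts_nontrivial hconn hnt) hv h1 hcut
  exact hB.adj_iff.2 ⟨h1, h2, h⟩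

/-! ### Leaves of trees and spanning paths of blocks -/

lemma notMem_internalVertices_iff [Finite V] {T : SimpleGraph V} {v : V} :
    v ∉ internalVertices T ↔ (T.neighborSet v).Subsingleton := by
  rw [internalVertices, Set.mem_ofPred_eq, not_le, Nat.lt_succ_iff, Set.ncard_le_one_iff_subsingleton]

/-- A tree minus a leaf is still connected, and it spans `G - v`. -/
lemma not_isCutVertex_of_subsingleton {T : SimpleGraph V} (hT : IsSpanningTree G T) {v : V}
    (hv : (T.neighborSet v).Subsingleton) : ¬ IsCutVertex G v := by
  rw [IsCutVertex, not_not]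
  refine (hT.2.connected.preconnected.induce_of_degree_eq_one (s := {v}ᶜ) ?_).mono
    (fun _ _ h => hT.1 h)
  simpa using hv

lemma exists_isPath_support_of_isClique [DecidableEq V] (S : Finset V) : ∀ {u v : V}, u ≠ v →
    u ∉ S → v ∉ S → G.IsClique (insert u (insert v (S : Set V))) →
    ∃ p : G.Walk u v, p.IsPath ∧ ∀ w, w ∈ p.support ↔ w = u ∨ w = v ∨ w ∈ S := by
  induction S using Finset.induction_on with
  | empty =>
    intro u v huv _ _ hcl
    have hadj : G.Adj u v := hcl (by simp) (by simp) huv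
    exact ⟨.cons hadj .nil, by simp [huv], by simp⟩
  | insert a S ha ih =>
    intro u v huv hu hv hcl
    rw [Finset.mem_insert, not_or] at hu hv
    obtain ⟨p, hp, hsup⟩ := ih (Ne.symm hv.1) ha hv.2 (hcl.subset (by
      intro x hx; simp at hx ⊢; tauto))
    have hadj : G.Adj u a := hcl (by simp) (by simp) hu.1
    refine ⟨.cons hadj p, hp.cons ?_, ?_⟩
    · rw [hsup]; simp [hu, huv]
    · intro w
      rw [Walk.support_cons, List.mem_cons, hsup, Finset.mem_insert]
      tauto

lemma IsBlock.hasSpanningPath {B : G.Subgraph} (hB : IsBlock B) {u v : V} {p : G.Walk u v}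
    (hp : p.IsPath) (h : ∀ w, w ∈ p.support ↔ w ∈ B.verts) : HasSpanningPath B u v :=
  ⟨p, hp, hB.toSubgraph_le fun w => (h w).1, fun w => (h w).2⟩

lemma IsBlock.hasSpanningPath_of_isClique [Finite V] {B : G.Subgraph} (hB : IsBlock B)
    (hcl : G.IsClique B.verts) {u v : V} (hu : u ∈ B.verts) (hv : v ∈ B.verts) (huv : u ≠ v) :
    HasSpanningPath B u v := by
  classical
  have hfin : (B.verts \ {u, v}).Finite := Set.toFinite _
  obtain ⟨p, hp, hsup⟩ := exists_isPath_support_of_isClique (G := G) hfin.toFinset huv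
    (by simp) (by simp) (hcl.subset (by
      intro x hx
      simp at hx
      rcases hx with rfl | rfl | hx
      exacts [hu, hv, hx.1]))
  refine hB.hasSpanningPath hp fun w => ?_
  rw [hsup]
  simp only [Set.Finite.mem_toFinset, Set.mem_sdiff, Set.mem_insert_iff, Set.mem_singleton_iff]
  constructor
  · rintro (rfl | rfl | h)
    exacts [hu, hv, h.1]
  · tauto

lemma IsEdgeSubgraph.isClique {B : G.Subgraph} (hB : IsEdgeSubgraph B) : G.IsClique B.verts := by
  obtain ⟨u, v, h, rfl⟩ := hB
  simp [h]

lemma isClique_or_isCycleSubgraph (hG : IsBlockGraph G ∨ IsCactusGraph G) {B : G.Subgraph}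
    (hB : IsBlock B) : G.IsClique B.verts ∨ IsCycleSubgraph B := by
  rcases hG with hG | hG
  · exact .inl (hG B hB)
  · exact (hG B hB).symm.imp_left IsEdgeSubgraph.isClique

/-- Adjacent vertices of a cycle block are joined by a spanning path. -/
lemma IsBlock.hasSpanningPath_of_isCycle {B : G.Subgraph} (hB : IsBlock B)
    (hcyc : IsCycleSubgraph B) {x y : V} (hxy : B.Adj x y) : HasSpanningPath B y x := by
  classical
  obtain ⟨u, p, hp, rfl⟩ := hcyc
  have hx : x ∈ p.support := (Walk.mem_verts_toSubgraph _).1 (p.toSubgraph.edge_vert hxy)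
  rw [← p.toSubgraph_rotate hx] at hxy
  -- The cycle is traversed from `x` in the direction that visits `y` first, so its tail is the
  -- required path.
  obtain ⟨q, hq, rfl, hverts⟩ := (hp.rotate hx).exists_isCycle_snd_verts_eq hxy
  refine hB.hasSpanningPath hq.isPath_tail fun w => ?_
  rw [← p.toSubgraph_rotate hx, ← hverts, Walk.mem_verts_toSubgraph,
    Walk.support_tail_of_not_nil _ hq.not_nil]
  refine ⟨List.mem_of_mem_tail, fun hw => ?_⟩
  rw [← Walk.cons_tail_support, List.mem_cons] at hw
  rcases hw with rfl | hw
  · exact Walk.end_mem_tail_support hq.not_nil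
  · exact hw

/-! ### Every bad block contains a leaf -/

/-- A vertex of a clique block at maximal distance from the only cut vertex is a leaf. -/
lemma exists_leaf_of_isClique [Finite V] (hconn : G.Connected) (hnt : (blocks G).Nontrivial)
    {T : SimpleGraph V} (hT : IsSpanningTree G T) {B : G.Subgraph} (hB : IsBlock B)
    (hbad : ¬ IsGood B) (hcl : G.IsClique B.verts) :
    ∃ x ∈ B.verts, ¬ IsCutVertex G x ∧ (T.neighborSet x).Subsingleton := by
  obtain ⟨c, hcB, hc⟩ := hB.exists_isCutVertex hconn hnt
  have hnc : ∀ x ∈ B.verts, x ≠ c → ¬ IsCutVertex G x := fun x hx hxc hcut =>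
    hbad ⟨x, hx, c, hcB, hxc, hcut, hc, hB.hasSpanningPath_of_isClique hcl hx hcB hxc⟩
  obtain ⟨x, ⟨hxB, hxc⟩, hmax⟩ := (Set.toFinite {x | x ∈ B.verts ∧ x ≠ c}).exists_maximalFor
    (T.dist c) _ ((hB.verts_nontrivial hconn hnt).exists_ne c)
  refine ⟨x, hxB, hnc x hxB hxc, ?_⟩
  -- A `T`-neighbour farther from `c` would be a vertex of `B` other than `c`, against the choice of
  -- `x`.
  have key : ∀ a, T.Adj x a → T.dist c x = T.dist c a + 1 := by
    intro a ha
    rcases hT.2.dist_eq_dist_add_one_of_adj c ha with h | h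
    · exact h
    · have haB := hB.adj_of_not_isCutVertex hconn hnt hxB (hnc x hxB hxc) (hT.1 ha)
      have hac : a ≠ c := by
        rintro rfl
        simp at h
      have := hmax ⟨B.edge_vert haB.symm, hac⟩ (by omega)
      omega
  obtain ⟨p, hp⟩ := hT.2.connected.exists_isPath x c
  -- Each neighbour of `x` is nearer to `c`, so a shortest path from it, prefixed by `x`, is the
  -- unique path from `x` to `c`.
  have hpen : ∀ a, T.Adj x a → a = p.snd := by
    intro a ha
    refine hT.2.isAcyclic.eq_snd_of_adj_start hp ha ?_
    obtain ⟨q, hq, hlen⟩ := hT.2.connected.exists_path_of_dist a c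
    have hxq : x ∉ q.support := by
      classical
      intro hx
      have h2 := key a ha
      have h3 := T.dist_le (q.dropUntil x hx)
      have h4 := q.length_dropUntil_le_length hx
      rw [T.dist_comm] at h3
      rw [T.dist_comm] at hlen
      omega
    have := hT.2.isAcyclic.subsingleton_path x c |>.elim ⟨p, hp⟩ ⟨_, hq.cons hxq (h := ha)⟩
    rw [Subtype.mk.inj this]
    simp
  intro a ha b hb
  rw [hpen a ha, hpen b hb]

/-- A non-cut vertex has all its `G`-neighbours in `B`, hence only two; if it is not a leaf, `T`
uses both of its cycle edges. An edge of the cycle missing from `T` therefore joins two cut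
vertices, and the rest of the cycle makes `B` good. -/
lemma exists_leaf_of_isCycle [Finite V] (hconn : G.Connected) (hnt : (blocks G).Nontrivial)
    {T : SimpleGraph V} (hT : IsSpanningTree G T) {B : G.Subgraph} (hB : IsBlock B)
    (hbad : ¬ IsGood B) (hcyc : IsCycleSubgraph B) :
    ∃ x ∈ B.verts, ¬ IsCutVertex G x ∧ (T.neighborSet x).Subsingleton := by
  by_contra! hcon
  have key : ∀ x y, B.Adj x y → ¬ IsCutVertex G x → T.Adj x y := by
    intro x y hxy hx
    have hxB := B.edge_vert hxy
    have h2 := (Set.not_subsingleton_iff.2 (hcon x hxB hx))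
    rw [← Set.ncard_le_one_iff_subsingleton] at h2
    have hsub : T.neighborSet x ⊆ B.neighborSet x := fun w hw =>
      hB.adj_of_not_isCutVertex hconn hnt hxB hx (hT.1 hw)
    have hcard : (B.neighborSet x).ncard = 2 := by
      obtain ⟨u, p, hp, rfl⟩ := hcyc
      exact hp.ncard_neighborSet_toSubgraph_eq_two ((Walk.mem_verts_toSubgraph _).1 hxB)
    have := Set.eq_of_subset_of_ncard_le hsub (by omega)
    rw [← SimpleGraph.mem_neighborSet, this]
    exact hxy
  obtain ⟨x, y, hxy, hTxy⟩ : ∃ x y, B.Adj x y ∧ ¬ T.Adj x y := by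
    by_contra! hall
    obtain ⟨u, p, hp, rfl⟩ := hcyc
    have hedge : ∀ e ∈ p.edges, e ∈ T.edgeSet := by
      intro e he
      induction e with | _ x y
      exact hall x y (Walk.adj_toSubgraph_iff_mem_edges.2 he)
    exact hT.2.isAcyclic _ (hp.transfer hedge)
  have hx : IsCutVertex G x := by_contra fun h => hTxy (key x y hxy h)
  have hy : IsCutVertex G y := by_contra fun h => hTxy (key y x hxy.symm h).symm
  exact hbad ⟨y, B.edge_vert hxy.symm, x, B.edge_vert hxy, hxy.ne.symm, hy, hx,
    hB.hasSpanningPath_of_isCycle hcyc hxy⟩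

lemma exists_leaf_of_mem_badBlocks [Finite V] (hconn : G.Connected)
    (hG : IsBlockGraph G ∨ IsCactusGraph G) (hnt : (blocks G).Nontrivial)
    {T : SimpleGraph V} (hT : IsSpanningTree G T) {B : G.Subgraph} (hB : B ∈ badBlocks G) :
    ∃ x ∈ B.verts, ¬ IsCutVertex G x ∧ (T.neighborSet x).Subsingleton :=
  (isClique_or_isCycleSubgraph hG hB.1).elim (exists_leaf_of_isClique hconn hnt hT hB.1 hB.2)
    (exists_leaf_of_isCycle hconn hnt hT hB.1 hB.2)

lemma ncard_badBlocks_le [Finite V] (hconn : G.Connected)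
    (hG : IsBlockGraph G ∨ IsCactusGraph G) (hnt : (blocks G).Nontrivial)
    {T : SimpleGraph V} (hT : IsSpanningTree G T) :
    (badBlocks G).ncard ≤ (internalVertices T)ᶜ.ncard := by
  have := hconn.nonempty
  choose! f hfB hcut hleaf using
    fun B (hB : B ∈ badBlocks G) => exists_leaf_of_mem_badBlocks hconn hG hnt hT hB
  refine Set.ncard_le_ncard_of_injOn f
    (fun B hB => notMem_internalVertices_iff.2 (hleaf B hB)) fun B hB C hC hBC => ?_
  exact hB.1.eq_of_not_isCutVertex hC.1 (hB.1.verts_nontrivial hconn hnt)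
    (hC.1.verts_nontrivial hconn hnt) (hfB B hB) (hBC ▸ hfB C hC) (hcut B hB)

/-! ### A spanning tree made of spanning paths -/

/-- The edges of a path contain no cycle. -/
lemma not_isCycle_of_edges_subset {u v : V} (p : G.Walk u v) (hp : p.IsPath) {w : V}
    (c : G.Walk w w) (hc : c.IsCycle) : ¬ c.edges ⊆ p.edges := by
  induction p with
  | nil =>
    intro h
    cases c with
    | nil => exact Walk.not_isCycle_nil hc
    | cons _ _ => simp at h
  | @cons a b d hadj q ih =>
    intro h
    rw [Walk.cons_isPath_iff] at hp
    by_cases ha : a ∈ c.support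
    -- The start of a path has one neighbour along it, whereas a vertex of a cycle has two.
    · have hsub : c.toSubgraph.neighborSet a ⊆ {b} := by
        intro x hx
        have := h (Walk.adj_toSubgraph_iff_mem_edges.1 hx)
        rw [Walk.edges_cons, List.mem_cons] at this
        rcases this with h | h
        · simpa [hadj.ne] using h
        · exact absurd (q.fst_mem_support_of_mem_edges h) hp.2
      have h1 := Set.ncard_le_ncard hsub
      rw [hc.ncard_neighborSet_toSubgraph_eq_two ha, Set.ncard_singleton] at h1
      omega
    · refine ih hp.1 fun e he => ?_
      have := h he
      rw [Walk.edges_cons, List.mem_cons] at this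
      refine this.resolve_left ?_
      rintro rfl
      exact ha (c.fst_mem_support_of_mem_edges he)

/-- A spanning path of a block from a cut vertex, to another cut vertex if the block is good. -/
lemma IsBlock.exists_spanningPath [Finite V] (hconn : G.Connected)
    (hG : IsBlockGraph G ∨ IsCactusGraph G) (hnt : (blocks G).Nontrivial) {B : G.Subgraph}
    (hB : IsBlock B) : ∃ (u v : V) (p : G.Walk u v), p.IsPath ∧ p.toSubgraph ≤ B ∧
      (∀ w ∈ B.verts, w ∈ p.support) ∧ IsCutVertex G u ∧ (IsGood B → IsCutVertex G v) := by
  by_cases hgood : IsGood B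
  · obtain ⟨u, -, v, -, -, hu, hv, p, hp, hle, hsup⟩ := hgood
    exact ⟨u, v, p, hp, hle, hsup, hu, fun _ => hv⟩
  · obtain ⟨u, huB, hu⟩ := hB.exists_isCutVertex hconn hnt
    obtain ⟨v, hv⟩ := hB.exists_adj (hB.verts_nontrivial hconn hnt) huB
    obtain ⟨p, hp, hle, hsup⟩ : HasSpanningPath B u v := by
      rcases isClique_or_isCycleSubgraph hG hB with h | h
      · exact hB.hasSpanningPath_of_isClique h huB (B.edge_vert hv.symm) hv.ne
      · exact hB.hasSpanningPath_of_isCycle h hv.symm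
    exact ⟨u, v, p, hp, hle, hsup, hu, fun h => absurd h hgood⟩

/-- The union of spanning paths, one for each block, is a spanning tree. -/
lemma isSpanningTree_of_spanningPaths [Finite V] (hconn : G.Connected)
    {T : SimpleGraph V} (u v : G.Subgraph → V) (p : ∀ B, G.Walk (u B) (v B))
    (hp : ∀ B, IsBlock B → (p B).IsPath) (hle : ∀ B, IsBlock B → (p B).toSubgraph ≤ B)
    (hsup : ∀ B, IsBlock B → ∀ w ∈ B.verts, w ∈ (p B).support)
    (hT : ∀ x y, T.Adj x y ↔ ∃ B, IsBlock B ∧ (p B).toSubgraph.Adj x y) :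
    IsSpanningTree G T := by
  have hTG : T ≤ G := by
    intro x y hxy
    obtain ⟨B, -, h⟩ := (hT x y).1 hxy
    exact h.adj_sub
  refine ⟨hTG, ⟨?_, ?_⟩⟩
  · have hne := hconn.nonempty
    refine ⟨fun a b => ?_⟩
    have hadj : ∀ x y, G.Adj x y → T.Reachable x y := by
      intro x y hxy
      obtain ⟨B, hB, hx, hy⟩ := exists_isBlock_of_adj hxy
      have hmap : ∀ z w : (p B).toSubgraph.verts, (p B).toSubgraph.coe.Reachable z w →
          T.Reachable z w := by
        rintro z w ⟨q⟩
        exact ⟨q.map ⟨Subtype.val, fun {a b} h => (hT a b).2 ⟨B, hB, h⟩⟩⟩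
      exact hmap ⟨x, (Walk.mem_verts_toSubgraph _).2 (hsup B hB x hx)⟩
        ⟨y, (Walk.mem_verts_toSubgraph _).2 (hsup B hB y hy)⟩
        ((p B).toSubgraph_connected.preconnected _ _)
    obtain ⟨q⟩ := hconn.preconnected a b
    induction q with
    | nil => exact .rfl
    | cons h q ih => exact (hadj _ _ h).trans ih
  · intro a c hc
    have hc' : (c.mapLe hTG).IsCycle := (Walk.isCycle_mapLe hTG).2 hc
    -- The cycle lies in one block `B`. Each of its edges comes from the path of some block, which
    -- shares both ends with `B` and so equals `B`; the cycle would thus use only edges of one path.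
    obtain ⟨B, hB, hBle⟩ := (isNonseparable_toSubgraph_of_isCycle hc').exists_isBlock_ge
    refine not_isCycle_of_edges_subset (p B) (hp B hB) _ hc' fun e he => ?_
    induction e with | _ x y
    have hxy : B.Adj x y := hBle.2 (Walk.adj_toSubgraph_iff_mem_edges.2 he)
    have hTxy : T.Adj x y := by
      rw [Walk.edges_mapLe_eq_edges] at he
      exact c.adj_of_mem_edges he
    obtain ⟨D, hD, hadj⟩ := (hT x y).1 hTxy
    have hDxy := (hle D hD).2 hadj
    obtain rfl := hB.eq_of_mem hD hxy.ne (B.edge_vert hxy) (B.edge_vert hxy.symm)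
      (D.edge_vert hDxy) (D.edge_vert hDxy.symm)
    exact Walk.adj_toSubgraph_iff_mem_edges.1 hadj

lemma exists_isSpanningTree_le_ncard [Finite V] (hconn : G.Connected)
    (hG : IsBlockGraph G ∨ IsCactusGraph G) (hnt : (blocks G).Nontrivial) :
    ∃ T, IsSpanningTree G T ∧ (internalVertices T)ᶜ.ncard ≤ (badBlocks G).ncard := by
  have hex : ∀ B : G.Subgraph, ∃ (u v : V) (p : G.Walk u v), IsBlock B → p.IsPath ∧
      p.toSubgraph ≤ B ∧ (∀ w ∈ B.verts, w ∈ p.support) ∧ IsCutVertex G u ∧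
      (IsGood B → IsCutVertex G v) := by
    intro B
    by_cases hB : IsBlock B
    · obtain ⟨u, v, p, h⟩ := hB.exists_spanningPath hconn hG hnt
      exact ⟨u, v, p, fun _ => h⟩
    -- A dummy walk: `T` only uses the walks of actual blocks.
    · obtain ⟨w⟩ := hconn.nonempty
      exact ⟨w, w, .nil, fun h => absurd h hB⟩
  choose u v p h using hex
  let T : SimpleGraph V :=
    { Adj := fun x y => ∃ B, IsBlock B ∧ (p B).toSubgraph.Adj x y
      symm := ⟨fun x y ⟨B, hB, hxy⟩ => ⟨B, hB, hxy.symm⟩⟩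
      loopless := ⟨fun x ⟨B, _, hx⟩ => hx.ne rfl⟩ }
  have hT : IsSpanningTree G T := isSpanningTree_of_spanningPaths hconn u v p
    (fun B hB => (h B hB).1) (fun B hB => (h B hB).2.1) (fun B hB => (h B hB).2.2.1)
    fun _ _ => Iff.rfl
  refine ⟨T, hT, ?_⟩
  have hsub : (internalVertices T)ᶜ ⊆ v '' badBlocks G := by
    intro x hx
    have hx := notMem_internalVertices_iff.1 hx
    have hcut := not_isCutVertex_of_subsingleton hT hx
    obtain ⟨C, hC⟩ := hnt.nonempty
    have hV : Nontrivial V := by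
      obtain ⟨a, -, b, -, hab⟩ := IsBlock.verts_nontrivial hconn hnt hC
      exact ⟨a, b, hab⟩
    obtain ⟨y, hxy⟩ := hconn.preconnected.exists_adj_of_nontrivial x
    obtain ⟨B, hB, hxB, -⟩ := exists_isBlock_of_adj hxy
    obtain ⟨hp, -, hsup, hu, hv⟩ := h B hB
    obtain ⟨i, hi, hlen⟩ := Walk.mem_support_iff_exists_getVert.1 (hsup x hxB)
    -- The leaf `x` is not the start of the path, which is a cut vertex, and not an inner vertex,
    -- which has two neighbours on the path.
    have hxv : v B = x := by
      by_contra hne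
      have h0 : i ≠ 0 := by
        rintro rfl
        rw [Walk.getVert_zero] at hi
        exact hcut (hi ▸ hu)
      have h1 : i ≠ (p B).length := by
        rintro rfl
        rw [Walk.getVert_length] at hi
        exact hne hi
      have h2 := hp.ncard_neighborSet_toSubgraph_internal_eq_two h0 (by omega)
      rw [hi] at h2
      have hle : (p B).toSubgraph.neighborSet x ⊆ T.neighborSet x := fun y hy => ⟨B, hB, hy⟩
      have := Set.ncard_le_one_iff_subsingleton.2 (hx.anti hle)
      omega
    exact ⟨B, ⟨hB, fun hgood => hcut (hxv ▸ hv hgood)⟩, hxv⟩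
  exact (Set.ncard_le_ncard hsub).trans (Set.ncard_image_le (Set.toFinite _))

end MIST

theorem mainTheorem6 {V : Type*} [Fintype V] (G : SimpleGraph V) (hconn : G.Connected)
    (hG : MIST.IsBlockGraph G ∨ MIST.IsCactusGraph G) (hnontriv : (MIST.blocks G).Nontrivial) :
    (MIST.badBlocks G).ncard ≤ Fintype.card V ∧
      IsGreatest (MIST.internalCounts G) (Fintype.card V - (MIST.badBlocks G).ncard) := by
  have hcard : ∀ T : SimpleGraph V, (MIST.internalVertices T).ncard +
      (MIST.internalVertices T)ᶜ.ncard = Fintype.card V := fun T => by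
    rw [Set.ncard_add_ncard_compl, Nat.card_eq_fintype_card]
  obtain ⟨T, hT, hle⟩ := MIST.exists_isSpanningTree_le_ncard hconn hG hnontriv
  have hge := MIST.ncard_badBlocks_le hconn hG hnontriv hT
  have hTcard := hcard T
  -- For this `T` both bounds meet: it has exactly as many non-internal vertices as there are bad
  -- blocks.
  refine ⟨by omega, ⟨T, hT, by omega⟩, ?_⟩
  rintro k ⟨S, hS, rfl⟩
  have hSge := MIST.ncard_badBlocks_le hconn hG hnontriv hS
  have hScard := hcard S
  omega
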